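/- Let $F$ be an algebraically closed field of characteristic zero, $G$ a finite group with identity $e$, and $A=\bigoplus_{g\in G}A_g$ an associative (not necessarily unital) $G$-graded $F$-algebra. The grading is called regular with commutation function $\theta$ if (i) for all $n\ge 1$, all $\bar g=(g_1,\dots,g_n)\in G^n$ and all $\sigma\in \mathrm{Sym}(n)$ with $g_1\cdots g_n=g_{\sigma(1)}\cdots g_{\sigma(n)}$, the scalar $\theta_{(\bar g,\sigma)}\in F^\times$ satisfies $a_1\cdots a_n=\theta_{(\bar g,\sigma)}\,a_{\sigma(1)}\cdots a_{\sigma(n)}$ for all $a_i\in A_{g_i}$; and (ii) for all $n\ge 1$ and $(g_1,\dots,g_n)\in G^n$ there are $a_i\in A_{g_i}$ with $a_1\cdots a_n\ne 0$. For commuting $g,h$ write $\theta_{g,h}=\theta_{((g,h),(1\,2))}$. The grading is nondegenerate if for every $g\ne e$ there is $h\in C_G(g)$ with $\theta_{g,h}\neq 1$. For a $2$-cocycle $\alpha\in Z^2(G,F^\times)$ (trivial action), let $F^\alpha G$ be the twisted group algebra, with basis $\{U_g\}_{g\in G}$, product $U_gU_h=\alpha(g,h)U_{gh}$, and its natural $G$-grading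 $(F^\alpha G)_g=FU_g$. Suppose that the grading on $A$ is regular and nondegenerate, with commutation function $\theta$, and that $\theta_{g,g}=1$ for all $g\in G$. Then there is an integer $r\geq 0$ with $|G|=r^2$; there is a $2$-cocycle $\alpha$ such that $F^\alpha G$ is regularly graded with commutation function $\theta$; and for every such $\alpha$ one has $F^\alpha G\cong M_r(F)$ as $F$-algebras, and, viewing the commutation matrix $$M_G=\bigl(U_gU_hU_g^{-1}U_h^{-1}\bigr)_{g,h\in G}\in M_{|G|}(F^\alpha G)$$ as a matrix in $M_{r^3}(F)$ by replacing each entry by its image under any $F$-algebra isomorphism $F^\alpha G\cong M_r(F)$, $$\det(M_G)=\pm r^{(r^3)}.$$ -/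

import Mathlib

/-! ## Regular gradings -/

/-- The product `a 0 * a 1 * ⋯ * a n` of a nonempty tuple; no unit element is needed. -/
def tupleProd {S : Type*} [Mul S] : {n : ℕ} → (Fin (n + 1) → S) → S
  | 0, a => a 0
  | _ + 1, a => tupleProd (fun i => a i.castSucc) * a (Fin.last _)

/-- Functions assigning a nonzero scalar `θ n g σ` to an `(n + 1)`-tuple `g` of elements of `G` and a
permutation `σ` of its positions. Only the values at the pairs with
`g 0 ⋯ g n = g (σ 0) ⋯ g (σ n)` are ever used. -/
abbrev CommFun (G F : Type*) [Field F] : Type _ :=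
  (n : ℕ) → (Fin (n + 1) → G) → Equiv.Perm (Fin (n + 1)) → Fˣ

/-- The value `θ_{g,h}` at the pair `(g, h)` and the transposition (meaningful if `g`, `h` commute). -/
def CommFun.pair {G F : Type*} [Field F] (θ : CommFun G F) (g h : G) : Fˣ :=
  θ 1 ![g, h] (Equiv.swap 0 1)

/-- `𝒜` is a regular `G`-grading of the associative (not necessarily unital) `F`-algebra `A`,
with commutation function `θ`. -/
structure IsRegularGrading {G F A : Type*} [Group G] [DecidableEq G] [Field F] [NonUnitalRing A]
    [Module F A] (𝒜 : G → Submodule F A) (θ : CommFun G F) : Prop where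
  isInternal : DirectSum.IsInternal 𝒜
  mul_mem : ∀ (g h : G) (a b : A), a ∈ 𝒜 g → b ∈ 𝒜 h → a * b ∈ 𝒜 (g * h)
  commutation : ∀ (n : ℕ) (g : Fin (n + 1) → G) (σ : Equiv.Perm (Fin (n + 1))),
    tupleProd g = tupleProd (g ∘ σ) → ∀ a : Fin (n + 1) → A, (∀ i, a i ∈ 𝒜 (g i)) →
      tupleProd a = (θ n g σ : F) • tupleProd (a ∘ σ)
  regularity : ∀ (n : ℕ) (g : Fin (n + 1) → G),
    ∃ a : Fin (n + 1) → A, (∀ i, a i ∈ 𝒜 (g i)) ∧ tupleProd a ≠ 0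

/-- Nondegeneracy: every `g ≠ e` has some `h` in its centralizer with `θ_{g,h} ≠ 1`. -/
def CommFun.Nondegenerate {G F : Type*} [Group G] [Field F] (θ : CommFun G F) : Prop :=
  ∀ g : G, g ≠ 1 → ∃ h : G, Commute g h ∧ θ.pair g h ≠ 1

/-! ## Twisted group algebras -/

/-- A 2-cocycle on `G` with values in the abelian group `M`, for the trivial action. -/
structure TwoCocycle (G M : Type*) [Group G] [CommGroup M] where
  toFun : G → G → M
  cocycle : ∀ g h k : G, toFun g h * toFun (g * h) k = toFun h k * toFun g (h * k)

namespace TwoCocycle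

variable {G M : Type*} [Group G] [CommGroup M] (α : TwoCocycle G M)

theorem one_left (g : G) : α.toFun 1 g = α.toFun 1 1 := by
  have h := α.cocycle 1 1 g
  simp only [one_mul] at h
  exact (mul_right_cancel h).symm

theorem one_right (g : G) : α.toFun g 1 = α.toFun 1 1 := by
  have h := α.cocycle g 1 1
  simp only [mul_one] at h
  exact mul_right_cancel h

theorem inv_symm (g : G) : α.toFun g g⁻¹ = α.toFun g⁻¹ g := by
  have h := α.cocycle g g⁻¹ g
  simp only [mul_inv_cancel, inv_mul_cancel, one_left, one_right] at h
  exact mul_right_cancel h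

end TwoCocycle

/-- The twisted group algebra `F^α G`, with `F`-basis `U_g` and product `U_g U_h = α(g,h) U_{gh}`. -/
def TwistedGroupAlgebra {G F : Type*} [Group G] [Field F] (_α : TwoCocycle G Fˣ) : Type _ := G →₀ F

namespace TwistedGroupAlgebra

variable {G F : Type*} [Group G] [Field F] (α : TwoCocycle G Fˣ)

noncomputable instance : AddCommGroup (TwistedGroupAlgebra α) :=
  inferInstanceAs (AddCommGroup (G →₀ F))

noncomputable instance : Module F (TwistedGroupAlgebra α) :=
  inferInstanceAs (Module F (G →₀ F))

/-- The `F`-basis `(U_g)` of `F^α G`. -/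
noncomputable def basis : Module.Basis G F (TwistedGroupAlgebra α) :=
  Module.Basis.ofRepr (LinearEquiv.refl F (G →₀ F))

/-- The bilinear product determined by `U_g U_h = α(g,h) U_{gh}`. -/
noncomputable def mulLin :
    TwistedGroupAlgebra α →ₗ[F] TwistedGroupAlgebra α →ₗ[F] TwistedGroupAlgebra α :=
  (basis α).constr F fun g => (basis α).constr F fun h =>
    (α.toFun g h : F) • basis α (g * h)

theorem mulLin_basis (g h : G) :
    mulLin α (basis α g) (basis α h) = (α.toFun g h : F) • basis α (g * h) := by
  simp [mulLin]

noncomputable instance : Mul (TwistedGroupAlgebra α) := ⟨fun x y => mulLin α x y⟩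

noncomputable instance : One (TwistedGroupAlgebra α) := ⟨((α.toFun 1 1)⁻¹ : Fˣ).val • basis α 1⟩

theorem mul_def (x y : TwistedGroupAlgebra α) : x * y = mulLin α x y := rfl

theorem one_def : (1 : TwistedGroupAlgebra α) = ((α.toFun 1 1)⁻¹ : Fˣ).val • basis α 1 := rfl

variable {α} in
theorem basis_induction {p : TwistedGroupAlgebra α → Prop} (x : TwistedGroupAlgebra α)
    (h0 : p 0) (hadd : ∀ x y, p x → p y → p (x + y)) (hsmul : ∀ (c : F) x, p x → p (c • x))
    (hbasis : ∀ g, p (basis α g)) : p x := by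
  have hx : x ∈ Submodule.span F (Set.range (basis α)) := (basis α).mem_span x
  induction hx using Submodule.span_induction with
  | mem x h => obtain ⟨g, rfl⟩ := h; exact hbasis g
  | zero => exact h0
  | add x y _ _ hx hy => exact hadd x y hx hy
  | smul c x _ hx => exact hsmul c x hx

theorem mulLin_assoc (x y z : TwistedGroupAlgebra α) :
    mulLin α (mulLin α x y) z = mulLin α x (mulLin α y z) := by
  induction x using basis_induction with
  | h0 => simp
  | hadd x x' hx hx' => simp [hx, hx']
  | hsmul c x hx => simp [hx]
  | hbasis g =>
    induction y using basis_induction with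
    | h0 => simp
    | hadd x x' hx hx' => simp [hx, hx']
    | hsmul c x hx => simp [hx]
    | hbasis h =>
      induction z using basis_induction with
      | h0 => simp
      | hadd x x' hx hx' => simp [hx, hx']
      | hsmul c x hx => simp [hx]
      | hbasis k =>
        simp only [mulLin_basis, map_smul, LinearMap.smul_apply, smul_smul, mul_assoc g h k]
        rw [← Units.val_mul, ← Units.val_mul, α.cocycle]

theorem mulLin_one_left (x : TwistedGroupAlgebra α) : mulLin α 1 x = x := by
  induction x using basis_induction with
  | h0 => simp
  | hadd x x' hx hx' => simp [hx, hx']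
  | hsmul c x hx => simp [hx]
  | hbasis g =>
    simp only [one_def, mulLin_basis, map_smul, LinearMap.smul_apply, smul_smul, one_mul,
      α.one_left g, ← Units.val_mul, inv_mul_cancel, Units.val_one, one_smul]

theorem mulLin_one_right (x : TwistedGroupAlgebra α) : mulLin α x 1 = x := by
  induction x using basis_induction with
  | h0 => simp
  | hadd x x' hx hx' => simp [hx, hx']
  | hsmul c x hx => simp [hx]
  | hbasis g =>
    simp only [one_def, mulLin_basis, map_smul, smul_smul, mul_one,
      α.one_right g, ← Units.val_mul, inv_mul_cancel, Units.val_one, one_smul]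

noncomputable instance : Ring (TwistedGroupAlgebra α) :=
  { (inferInstance : AddCommGroup (TwistedGroupAlgebra α)),
    (inferInstance : Mul (TwistedGroupAlgebra α)),
    (inferInstance : One (TwistedGroupAlgebra α)) with
    mul_assoc := mulLin_assoc α
    one_mul := mulLin_one_left α
    mul_one := mulLin_one_right α
    left_distrib := fun x y z => by simp only [mul_def, map_add]
    right_distrib := fun x y z => by simp only [mul_def, map_add, LinearMap.add_apply]
    zero_mul := fun x => by simp only [mul_def, map_zero, LinearMap.zero_apply]
    mul_zero := fun x => by simp only [mul_def, map_zero] }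

noncomputable instance : Algebra F (TwistedGroupAlgebra α) :=
  Algebra.ofModule
    (fun c x y => by simp only [mul_def, map_smul, LinearMap.smul_apply])
    (fun c x y => by simp only [mul_def, map_smul])

theorem basis_mul (g h : G) : basis α g * basis α h = (α.toFun g h : F) • basis α (g * h) :=
  mulLin_basis α g h

/-- The basis element `U_g`, as an invertible element of `F^α G`. -/
noncomputable def U (g : G) : (TwistedGroupAlgebra α)ˣ where
  val := basis α g
  inv := ((α.toFun g⁻¹ g)⁻¹ * (α.toFun 1 1)⁻¹ : Fˣ).val • basis α g⁻¹
  val_inv := by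
    rw [mul_smul_comm, basis_mul, smul_smul, α.inv_symm, mul_inv_cancel, one_def,
      ← Units.val_mul]
    congr 2
    rw [mul_right_comm, inv_mul_cancel, one_mul]
  inv_val := by
    rw [smul_mul_assoc, basis_mul, smul_smul, inv_mul_cancel, one_def, ← Units.val_mul]
    congr 2
    rw [mul_right_comm, inv_mul_cancel, one_mul]

/-- The natural `G`-grading of `F^α G`: the component of degree `g` is `F U_g`. -/
noncomputable def grading (g : G) : Submodule F (TwistedGroupAlgebra α) :=
  Submodule.span F {basis α g}

/-- The commutation matrix, with entries `U_g U_h U_g⁻¹ U_h⁻¹` in `F^α G`. -/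
noncomputable def commutationMatrix : Matrix G G (TwistedGroupAlgebra α) :=
  Matrix.of fun g h => ((U α g * U α h * (U α g)⁻¹ * (U α h)⁻¹ : (TwistedGroupAlgebra α)ˣ) :
    TwistedGroupAlgebra α)

/-- A `G × G` matrix over `F^α G`, viewed as a scalar matrix of size `|G| r` through an
isomorphism `φ : F^α G ≃ M_r(F)`: each entry `x` is replaced by the `r × r` block `φ x`. -/
noncomputable def toScalarMatrix {r : ℕ} (φ : TwistedGroupAlgebra α ≃ₐ[F] Matrix (Fin r) (Fin r) F)
    (M : Matrix G G (TwistedGroupAlgebra α)) : Matrix (G × Fin r) (G × Fin r) F :=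
  Matrix.comp G G (Fin r) (Fin r) F (M.map φ)

end TwistedGroupAlgebra

/-! The proof combines two facts: some `F^α G` realises θ, and every `F^α G` realising θ has the
stated structure.

Structure. If x is central and h commutes with g, comparing coefficients of x U_h = U_h x at gh
multiplies the g-coefficient of x by θ_{g,h}; nondegeneracy leaves only multiples of 1 in the
centre. The sum of all conjugates of x under the U_h is central and has |G| times the 1-coefficient
of x, so every nonzero ideal contains a nonzero scalar. Thus `F^α G` is simple, hence M_r(F) with r²
= |G|. For g ≠ 1, U_g is conjugate to a scalar multiple of itself with scalar ≠ 1, so its trace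
vanishes: (U_g⁻¹) and (U_g) are dual for the trace form up to the factor r. Block-diagonal factors
reduce the commutation matrix to (U_h U_g⁻¹), whose determinant follows from this duality
(`Matrix.det_of_trace_dual`).

Existence. Substitute one element a_g for every degree g, and regard a word in G as a function of
these elements. Since θ_{g,g} = 1, factors of equal degree may be exchanged, and in characteristic
zero polarization shows that no word vanishes identically. Scalar multiples of degree-one words,
recorded with their letters, therefore form a commutative cancellative monoid containing F^×. As F^×
is divisible, this inclusion has a retraction ρ (`exists_character`). Normalising ρ gives scalars
μ(w) on all words, which become the coefficients of the products of the U_g; α(g,k) = μ([g,k]) is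
the required cocycle. -/

/-! ### Determinants from trace-dual families -/

open scoped Kronecker in
theorem Matrix.det_of_trace_dual {F : Type*} [Field F] {r : ℕ} {G : Type*} [Fintype G]
    [DecidableEq G] (e : G ≃ Fin r × Fin r) (v w : G → Matrix (Fin r) (Fin r) F)
    (hvw : ∀ g h, (v g * w h).trace = if g = h then (r : F) else 0) :
    (Matrix.of fun (x y : G × Fin r) => (w y.1 * v x.1) x.2 y.2).det = (r : F) ^ (r ^ 3) ∨
    (Matrix.of fun (x y : G × Fin r) => (w y.1 * v x.1) x.2 y.2).det = -(r : F) ^ (r ^ 3) := by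
  let P : Matrix (Fin r × Fin r) (Fin r × Fin r) F := Matrix.of fun x y => v (e.symm x) y.1 y.2
  let Q : Matrix (Fin r × Fin r) (Fin r × Fin r) F := Matrix.of fun x y => w (e.symm y) x.1 x.2
  -- Rows of P and columns of Q are flattened matrices. The (i,j) entry of w_y v_x is ∑ₖ v_x(k,j)
  -- w_y(i,k); σ sends ((k,l),m) to ((m,k),l), matching the indices of P ⊗ 1 and Q ⊗ 1 in this sum.
  let σ : Equiv.Perm ((Fin r × Fin r) × Fin r) :=
    ⟨fun x => ((x.2, x.1.1), x.1.2), fun x => ((x.1.2, x.2), x.1.1), fun _ => rfl, fun _ => rfl⟩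
  -- The trace of v_x w_y pairs the (k,l) entry with the (l,k) entry, hence the swap of the row
  -- indices of Q.
  have h1 : (P * Q.submatrix (Equiv.prodComm _ _ : Equiv.Perm (Fin r × Fin r)) id)
      = (r : F) • (1 : Matrix _ _ F) := by
    ext x y
    have := hvw (e.symm x) (e.symm y)
    simp only [Matrix.trace, Matrix.diag, Matrix.mul_apply, e.symm.injective.eq_iff] at this
    simp [P, Q, Matrix.mul_apply, Fintype.sum_prod_type, Matrix.one_apply, this]
  have h2 := congrArg Matrix.det h1
  rw [Matrix.det_mul, Matrix.det_permute, Matrix.det_smul, Matrix.det_one, Fintype.card_prod,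
    Fintype.card_fin, mul_one] at h2
  have h3 : (Matrix.of fun (x y : G × Fin r) => (w y.1 * v x.1) x.2 y.2).submatrix
      (e.symm.prodCongr (Equiv.refl _)) (e.symm.prodCongr (Equiv.refl _)) =
      (P ⊗ₖ (1 : Matrix (Fin r) (Fin r) F)) *
        (Q ⊗ₖ (1 : Matrix (Fin r) (Fin r) F)).submatrix σ id := by
    ext ⟨x, i⟩ ⟨y, j⟩
    simp [P, Q, σ, Matrix.mul_apply, Fintype.sum_prod_type, Matrix.one_apply, mul_comm]
  have h4 := congrArg Matrix.det h3
  rw [Matrix.det_submatrix_equiv_self, Matrix.det_mul, Matrix.det_permute, Matrix.det_kronecker,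
    Matrix.det_kronecker, Matrix.det_one, one_pow, mul_one, mul_one, Fintype.card_fin] at h4
  have h5 : P.det ^ r * Q.det ^ r =
      ((Equiv.Perm.sign (Equiv.prodComm (Fin r) (Fin r) : Equiv.Perm (Fin r × Fin r)) : ℤ) : F) ^ r
        * (r : F) ^ (r ^ 3) := by
    rw [pow_succ r 2, pow_mul, pow_two r, ← h2, ← mul_pow, ← mul_pow]
    congr 1
    rcases Int.units_eq_one_or (Equiv.Perm.sign (Equiv.prodComm (Fin r) (Fin r) :
      Equiv.Perm (Fin r × Fin r))) with h | h <;> rw [h] <;> simp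
  rw [h4, mul_left_comm, h5]
  rcases Int.units_eq_one_or (Equiv.Perm.sign (Equiv.prodComm (Fin r) (Fin r) :
      Equiv.Perm (Fin r × Fin r))) with h | h <;>
  rcases Int.units_eq_one_or (Equiv.Perm.sign σ) with h' | h' <;>
  rcases neg_one_pow_eq_or F r with h'' | h'' <;> rw [h, h'] <;> simp [h'']

/-! ### Centre, simplicity and trace form of the twisted group algebra -/

namespace TwistedGroupAlgebra

variable {G F : Type*} [Group G] [Field F] (α : TwoCocycle G Fˣ)

theorem U_mul_U (g h : G) :
    ((U α g * U α h : (TwistedGroupAlgebra α)ˣ) : TwistedGroupAlgebra α) =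
      (α.toFun g h : F) • basis α (g * h) := by
  rw [Units.val_mul]; exact basis_mul α g h

theorem U_commutation [DecidableEq G] {θ : CommFun G F} (hα : IsRegularGrading (grading α) θ)
    {g h : G} (hgh : Commute g h) :
    basis α g * basis α h = (θ.pair g h : F) • (basis α h * basis α g) := by
  have := hα.commutation 1 ![g, h] (Equiv.swap 0 1) (by simpa [tupleProd] using hgh.eq)
    ![basis α g, basis α h] (by
      intro i; fin_cases i <;> exact Submodule.mem_span_singleton_self _)
  simpa [tupleProd, CommFun.pair] using this

theorem conj_basis (g h : G) : ∃ c : Fˣ,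
    (U α h : TwistedGroupAlgebra α) * basis α g * ((U α h)⁻¹ : (TwistedGroupAlgebra α)ˣ) =
      (c : F) • basis α (h * g * h⁻¹) := by
  refine ⟨α.toFun h g * (α.toFun h⁻¹ h)⁻¹ * (α.toFun 1 1)⁻¹ * α.toFun (h * g) h⁻¹, ?_⟩
  change basis α h * basis α g *
    (((α.toFun h⁻¹ h)⁻¹ * (α.toFun 1 1)⁻¹ : Fˣ).val • basis α h⁻¹) = _
  simp only [basis_mul, smul_mul_assoc, mul_smul_comm, smul_smul, ← Units.val_mul]
  congr 2
  simp only [mul_assoc, mul_comm, mul_left_comm]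

/-- The coefficient of the conjugate of `x` at the conjugate of a group element. -/
theorem repr_conj (x : TwistedGroupAlgebra α) (h : G) :
    (basis α).repr ((U α h : TwistedGroupAlgebra α) * x * ((U α h)⁻¹ : (TwistedGroupAlgebra α)ˣ)) 1
      = (basis α).repr x 1 := by
  induction x using basis_induction with
  | h0 => simp
  | hadd x y hx hy => simp [mul_add, add_mul, hx, hy]
  | hsmul c x hx => simp [hx]
  | hbasis g =>
    by_cases hg : g = 1
    · subst hg
      have : basis α 1 = (α.toFun 1 1 : F) • (1 : TwistedGroupAlgebra α) := by
        rw [one_def, smul_smul, ← Units.val_mul, mul_inv_cancel, Units.val_one, one_smul]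
      rw [this]
      simp
    · obtain ⟨c, hc⟩ := conj_basis α g h
      have hne : h * g * h⁻¹ ≠ 1 := by simpa using hg
      rw [hc]
      simp [Module.Basis.repr_self, hg]

/-- Since g and h commute, only the U_g term of x contributes to the coefficient at gh on either
side. -/
theorem repr_conj_commute [DecidableEq G] {θ : CommFun G F}
    (hα : IsRegularGrading (grading α) θ) (x : TwistedGroupAlgebra α) {g h : G}
    (hgh : Commute g h) :
    (basis α).repr (x * basis α h) (g * h)
      = (θ.pair g h : F) * (basis α).repr (basis α h * x) (g * h) := by
  induction x using basis_induction with
  | h0 => simp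
  | hadd x y hx hy => simp [mul_add, add_mul, hx, hy]
  | hsmul c x hx => simp only [smul_mul_assoc, mul_smul_comm, map_smul, Finsupp.smul_apply, hx,
      smul_eq_mul]; ring
  | hbasis k =>
    by_cases hk : k = g
    · subst hk
      rw [U_commutation α hα hgh]; simp
    · have h1 : k * h ≠ g * h := by simpa using hk
      have h2 : h * k ≠ g * h := by rw [hgh.eq]; simpa using hk
      rw [basis_mul, basis_mul]
      simp [Module.Basis.repr_self, hk, h2]

theorem repr_eq_zero_of_central [DecidableEq G] {θ : CommFun G F}
    (hα : IsRegularGrading (grading α) θ) (hnd : θ.Nondegenerate) {x : TwistedGroupAlgebra α}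
    (hx : ∀ h, basis α h * x = x * basis α h) {g : G} (hg : g ≠ 1) :
    (basis α).repr x g = 0 := by
  obtain ⟨h, hgh, hθ⟩ := hnd g hg
  have h1 := repr_conj_commute α hα x hgh
  rw [hx] at h1
  have h2 : (basis α).repr (x * basis α h) (g * h) = 0 := by
    by_contra h0
    exact hθ (Units.ext (by simpa using (mul_right_cancel₀ h0 ((one_mul _).trans h1)).symm))
  have h3 : (basis α).repr (x * basis α h) (g * h) = (α.toFun g h : F) * (basis α).repr x g := by
    clear hx h1 h2
    induction x using basis_induction with
    | h0 => simp
    | hadd x y hx hy => simp [mul_add, add_mul, hx, hy]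
    | hsmul c x hx => simp only [smul_mul_assoc, map_smul, Finsupp.smul_apply, hx,
        smul_eq_mul]; ring
    | hbasis k =>
      rw [basis_mul]
      by_cases hk : k = g
      · subst hk; simp
      · simp [Module.Basis.repr_self, hk]
  rw [h3] at h2
  simpa using h2

theorem eq_algebraMap_of_central [DecidableEq G] {θ : CommFun G F}
    (hα : IsRegularGrading (grading α) θ) (hnd : θ.Nondegenerate) {x : TwistedGroupAlgebra α}
    (hx : ∀ h, basis α h * x = x * basis α h) :
    x = ((α.toFun 1 1 : F) * (basis α).repr x 1) • (1 : TwistedGroupAlgebra α) := by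
  apply (basis α).repr.injective
  ext g
  by_cases hg : g = 1
  · subst hg
    simp [one_def, mul_comm]
  · rw [repr_eq_zero_of_central α hα hnd hx hg]
    simp [one_def, hg]

/-- U_k U_h is a scalar multiple of U_{kh}, and the scalar cancels in the conjugation: G acts by
conjugation although g ↦ U_g is not multiplicative. -/
theorem conj_conj (x : TwistedGroupAlgebra α) (k h : G) :
    (U α k : TwistedGroupAlgebra α) * ((U α h : TwistedGroupAlgebra α) * x *
        ((U α h)⁻¹ : (TwistedGroupAlgebra α)ˣ)) * ((U α k)⁻¹ : (TwistedGroupAlgebra α)ˣ) =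
      (U α (k * h) : TwistedGroupAlgebra α) * x *
        ((U α (k * h))⁻¹ : (TwistedGroupAlgebra α)ˣ) := by
  set c : (TwistedGroupAlgebra α)ˣ := Units.map (algebraMap F _).toMonoidHom (α.toFun k h) with hc
  have hU : U α k * U α h = c * U α (k * h) := by
    ext
    rw [U_mul_U, Units.val_mul, Algebra.smul_def]
    rfl
  have hcomm : ∀ y : TwistedGroupAlgebra α, (c : TwistedGroupAlgebra α) * y = y * c :=
    fun y => Algebra.commutes _ y
  calc _ = ((U α k * U α h : (TwistedGroupAlgebra α)ˣ) : TwistedGroupAlgebra α) * x *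
        ((U α k * U α h)⁻¹ : (TwistedGroupAlgebra α)ˣ) := by
        rw [mul_inv_rev]; simp only [Units.val_mul, mul_assoc]
    _ = c * (U α (k * h) * x * ((U α (k * h))⁻¹ : (TwistedGroupAlgebra α)ˣ)) *
        (c⁻¹ : (TwistedGroupAlgebra α)ˣ) := by
        rw [hU, mul_inv_rev]; simp only [Units.val_mul, mul_assoc]
    _ = _ := by rw [hcomm, Units.mul_inv_cancel_right]

theorem basis_mul_sum_conj [Fintype G] (x : TwistedGroupAlgebra α) (k : G) :
    basis α k * ∑ h, (U α h : TwistedGroupAlgebra α) * x * ((U α h)⁻¹ : (TwistedGroupAlgebra α)ˣ) =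
    (∑ h, (U α h : TwistedGroupAlgebra α) * x * ((U α h)⁻¹ : (TwistedGroupAlgebra α)ˣ)) *
      basis α k := by
  change (U α k : TwistedGroupAlgebra α) * _ = _ * (U α k : TwistedGroupAlgebra α)
  rw [← Units.mul_inv_eq_iff_eq_mul, Finset.mul_sum, Finset.sum_mul]
  exact Fintype.sum_equiv (Equiv.mulLeft k) _ _ fun h => conj_conj α x k h

/-- The sum of conjugates turns an element of an ideal with nonzero 1-coefficient into a nonzero
scalar, |G| being invertible in F; left multiplication by some U_{g⁻¹} moves any nonzero coefficient
to 1. -/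
theorem isSimpleRing [Fintype G] [DecidableEq G] [CharZero F] {θ : CommFun G F}
    (hα : IsRegularGrading (grading α) θ) (hnd : θ.Nondegenerate) :
    IsSimpleRing (TwistedGroupAlgebra α) := by
  have : Nontrivial (TwistedGroupAlgebra α) :=
    ⟨basis α 1, 0, (basis α).ne_zero 1⟩
  have key : ∀ (I : TwoSidedIdeal (TwistedGroupAlgebra α)) (x : TwistedGroupAlgebra α), x ∈ I →
      (basis α).repr x 1 ≠ 0 → I = ⊤ := by
    intro I x hx hx1
    have hy : (∑ h, (U α h : TwistedGroupAlgebra α) * x *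
        ((U α h)⁻¹ : (TwistedGroupAlgebra α)ˣ)) ∈ I :=
      sum_mem fun h _ => I.mul_mem_right _ _ (I.mul_mem_left _ _ hx)
    rw [eq_algebraMap_of_central α hα hnd (basis_mul_sum_conj α x), map_sum,
      Finsupp.finsetSum_apply, Finset.sum_congr rfl fun h _ => repr_conj α x h,
      Finset.sum_const, Finset.card_univ, nsmul_eq_mul] at hy
    set c : F := (α.toFun 1 1 : F) * ((Fintype.card G : F) * (basis α).repr x 1) with hc
    have hc0 : c ≠ 0 := mul_ne_zero (Units.ne_zero _)
      (mul_ne_zero (Nat.cast_ne_zero.2 Fintype.card_ne_zero) hx1)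
    have h1 := I.mul_mem_left (c⁻¹ • 1) _ hy
    rw [smul_mul_smul_comm, inv_mul_cancel₀ hc0, one_smul, one_mul] at h1
    exact (TwoSidedIdeal.one_mem_iff I).1 h1
  refine ⟨⟨fun I => ?_⟩⟩
  by_contra! hI
  obtain ⟨h0, h1⟩ := hI
  apply h0
  rw [eq_bot_iff]
  intro x hx
  rw [TwoSidedIdeal.mem_bot]
  by_contra hx0
  obtain ⟨g, hg⟩ : ∃ g, (basis α).repr x g ≠ 0 := by
    by_contra! h
    exact hx0 ((basis α).repr.injective (by ext g; simpa using h g))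
  refine h1 (key I (basis α g⁻¹ * x) (I.mul_mem_left _ _ hx) ?_)
  have : (basis α).repr (basis α g⁻¹ * x) 1 = (α.toFun g⁻¹ g : F) * (basis α).repr x g := by
    clear hx hx0 hg
    induction x using basis_induction with
    | h0 => simp
    | hadd x y hx hy => simp [mul_add, hx, hy]
    | hsmul c x hx => simp only [mul_smul_comm, map_smul, Finsupp.smul_apply, hx,
        smul_eq_mul]; ring
    | hbasis k =>
      rw [basis_mul]
      by_cases hk : k = g
      · subst hk; simp
      · have : g⁻¹ * k ≠ 1 := fun h => hk (inv_mul_eq_one.1 h).symm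
        simp [Module.Basis.repr_self, hk, this]
  rw [this]
  exact mul_ne_zero (Units.ne_zero _) hg

theorem exists_algEquiv_matrix [Fintype G] [DecidableEq G] [CharZero F] [IsAlgClosed F]
    {θ : CommFun G F} (hα : IsRegularGrading (grading α) θ) (hnd : θ.Nondegenerate) :
    ∃ r : ℕ, Fintype.card G = r ^ 2 ∧
      Nonempty (TwistedGroupAlgebra α ≃ₐ[F] Matrix (Fin r) (Fin r) F) := by
  have := isSimpleRing α hα hnd
  have : FiniteDimensional F (TwistedGroupAlgebra α) := (basis α).finiteDimensional_of_finite
  obtain ⟨r, -, ⟨φ⟩⟩ := IsSimpleRing.exists_algEquiv_matrix_of_isAlgClosed F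
    (TwistedGroupAlgebra α)
  refine ⟨r, ?_, ⟨φ⟩⟩
  rw [← Module.finrank_eq_card_basis (basis α), φ.toLinearEquiv.finrank_eq,
    Module.finrank_matrix]
  simp [pow_two]

/-- U_g is θ_{g,h} times its conjugate by U_h, and conjugation preserves the trace. -/
theorem trace_basis [DecidableEq G] {θ : CommFun G F} (hα : IsRegularGrading (grading α) θ)
    (hnd : θ.Nondegenerate) {r : ℕ} (φ : TwistedGroupAlgebra α ≃ₐ[F] Matrix (Fin r) (Fin r) F)
    {g : G} (hg : g ≠ 1) : (φ (basis α g)).trace = 0 := by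
  obtain ⟨h, hgh, hθ⟩ := hnd g hg
  have h1 : basis α g = (θ.pair g h : F) • ((U α h : TwistedGroupAlgebra α) * basis α g *
      ((U α h)⁻¹ : (TwistedGroupAlgebra α)ˣ)) := by
    rw [← smul_mul_assoc, Units.eq_mul_inv_iff_mul_eq]
    exact U_commutation α hα hgh
  have h2 := congrArg (fun x => (φ x).trace) h1
  simp only [map_smul, map_mul, Matrix.trace_smul, smul_eq_mul] at h2
  rw [Matrix.trace_mul_cycle, ← map_mul φ, Units.inv_mul, map_one, one_mul] at h2
  by_contra h0
  exact hθ (Units.ext (mul_right_cancel₀ h0 (by simpa using h2.symm)))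

theorem trace_dual [DecidableEq G] {θ : CommFun G F} (hα : IsRegularGrading (grading α) θ)
    (hnd : θ.Nondegenerate) {r : ℕ} (φ : TwistedGroupAlgebra α ≃ₐ[F] Matrix (Fin r) (Fin r) F)
    (g h : G) :
    (φ ((U α g)⁻¹ : (TwistedGroupAlgebra α)ˣ) * φ (basis α h)).trace =
      if g = h then (r : F) else 0 := by
  rw [← map_mul]
  split_ifs with hgh
  · subst hgh
    change (φ (_ * (U α g : TwistedGroupAlgebra α))).trace = _
    rw [Units.inv_mul, map_one, Matrix.trace_one, Fintype.card_fin]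
  · change (φ ((((α.toFun g⁻¹ g)⁻¹ * (α.toFun 1 1)⁻¹ : Fˣ).val • basis α g⁻¹) *
      basis α h)).trace = 0
    rw [smul_mul_assoc, basis_mul, map_smul, map_smul, Matrix.trace_smul, Matrix.trace_smul,
      trace_basis α hα hnd φ (fun h0 => hgh (inv_mul_eq_one.1 h0)), smul_zero, smul_zero]

/-- Up to block-diagonal factors with determinants inverse to each other, the commutation matrix
is the matrix with entries `U_h U_g⁻¹`. -/
theorem det_toScalarMatrix_commutationMatrix [Fintype G] [DecidableEq G] {r : ℕ}
    (φ : TwistedGroupAlgebra α ≃ₐ[F] Matrix (Fin r) (Fin r) F) :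
    (toScalarMatrix α φ (commutationMatrix α)).det =
      (Matrix.of fun (x y : G × Fin r) => (φ (basis α y.1) *
        φ ((U α x.1)⁻¹ : (TwistedGroupAlgebra α)ˣ)) x.2 y.2).det := by
  let D : Matrix G G (Matrix (Fin r) (Fin r) F) := Matrix.diagonal fun g => φ (U α g)
  let D' : Matrix G G (Matrix (Fin r) (Fin r) F) :=
    Matrix.diagonal fun g => φ ((U α g)⁻¹ : (TwistedGroupAlgebra α)ˣ)
  let K : Matrix G G (Matrix (Fin r) (Fin r) F) := Matrix.of fun g h => φ (basis α h) *
        φ ((U α g)⁻¹ : (TwistedGroupAlgebra α)ˣ)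
  let C := Matrix.compRingEquiv G (Fin r) F
  have h1 : (commutationMatrix α).map φ = D * K * D' := by
    ext g h : 2
    simp only [D, D', K, Matrix.mul_diagonal, Matrix.diagonal_mul, Matrix.map_apply,
      commutationMatrix, Matrix.of_apply, Units.val_mul, map_mul, mul_assoc]
    rfl
  have h2 : D * D' = 1 := by
    simp only [D, D', Matrix.diagonal_mul_diagonal, ← map_mul, Units.mul_inv, map_one,
      Matrix.diagonal_one]
  have h3 : (C D).det * (C D').det = 1 := by
    rw [← Matrix.det_mul, ← map_mul, h2, map_one, Matrix.det_one]
  change (C ((commutationMatrix α).map φ)).det = (C K).det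
  rw [h1, map_mul, map_mul, Matrix.det_mul, Matrix.det_mul, mul_right_comm, h3, one_mul]

theorem det_commutationMatrix [Fintype G] [DecidableEq G] {θ : CommFun G F}
    (hα : IsRegularGrading (grading α) θ) (hnd : θ.Nondegenerate) {r : ℕ}
    (φ : TwistedGroupAlgebra α ≃ₐ[F] Matrix (Fin r) (Fin r) F) (hr : Fintype.card G = r ^ 2) :
    (toScalarMatrix α φ (commutationMatrix α)).det = (r : F) ^ (r ^ 3) ∨
    (toScalarMatrix α φ (commutationMatrix α)).det = -(r : F) ^ (r ^ 3) := by
  rw [det_toScalarMatrix_commutationMatrix]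
  exact Matrix.det_of_trace_dual (Fintype.equivOfCardEq (by simp [hr, pow_two]))
    (fun g => φ ((U α g)⁻¹ : (TwistedGroupAlgebra α)ˣ)) (fun g => φ (basis α g))
    (trace_dual α hα hnd φ)

end TwistedGroupAlgebra

/-! ### Products of tuples and lists -/

theorem tupleProd_eq_prod_ofFn {M : Type*} [Monoid M] :
    ∀ {n : ℕ} (a : Fin (n + 1) → M), tupleProd a = (List.ofFn a).prod
  | 0, a => by simp [tupleProd]
  | n + 1, a => by
    rw [List.ofFn_succ', List.concat_eq_append, List.prod_append, ← tupleProd_eq_prod_ofFn]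
    simp [tupleProd]

theorem map_tupleProd {S T : Type*} [Mul S] [Mul T] (f : S → T)
    (hf : ∀ x y, f (x * y) = f x * f y) :
    ∀ {n : ℕ} (a : Fin (n + 1) → S), f (tupleProd a) = tupleProd (f ∘ a)
  | 0, _ => rfl
  | n + 1, a => by rw [tupleProd, hf, map_tupleProd f hf]; rfl

theorem List.exists_prod_set_set {M : Type*} [Monoid M] (L : List M) {i j : ℕ} (hij : i < j)
    (hj : j < L.length) : ∃ P Q R : M, (∃ l : List M, (∀ x ∈ l, x ∈ L) ∧ l.prod = Q) ∧
      ∀ x y, ((L.set i x).set j y).prod = P * x * Q * y * R := by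
  refine ⟨((L.take j).take i).prod, ((L.take j).drop (i + 1)).prod, (L.drop (j + 1)).prod,
    ⟨_, fun x hx => List.mem_of_mem_take (List.mem_of_mem_drop hx), rfl⟩, fun x y => ?_⟩
  rw [List.prod_set, List.length_set, if_pos hj, List.take_set, List.prod_set,
    List.length_take, if_pos (by omega), List.drop_set, if_pos (by omega)]

/-! ### Exchanging factors of equal degree -/

namespace IsRegularGrading

variable {G F A : Type*} [Group G] [DecidableEq G] [Field F] [NonUnitalRing A]
    [Module F A] {𝒜 : G → Submodule F A} {θ : CommFun G F}

theorem mul_comm_smul (h : IsRegularGrading 𝒜 θ) {g k : G} (hgk : Commute g k) {x y : A}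
    (hx : x ∈ 𝒜 g) (hy : y ∈ 𝒜 k) : x * y = (θ.pair g k : F) • (y * x) := by
  have := h.commutation 1 ![g, k] (Equiv.swap 0 1) (by simpa [tupleProd] using hgk.eq)
    ![x, y] (by intro i; fin_cases i <;> assumption)
  simpa [tupleProd, CommFun.pair] using this

theorem mul_comm_of_pair_self (h : IsRegularGrading 𝒜 θ) {g : G} (hg : θ.pair g g = 1) {x y : A}
    (hx : x ∈ 𝒜 g) (hy : y ∈ 𝒜 g) : x * y = y * x := by
  rw [h.mul_comm_smul (Commute.refl g) hx hy, hg, Units.val_one, one_smul]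

theorem prod_inr_mem (h : IsRegularGrading 𝒜 θ) (l : List G) (a : G → A) (ha : ∀ g, a g ∈ 𝒜 g) :
    l = [] ∨ ∃ x ∈ 𝒜 l.prod,
      (l.map fun g => (Unitization.inr (a g) : Unitization F A)).prod = Unitization.inr x := by
  induction l with
  | nil => exact Or.inl rfl
  | cons g l ih =>
    right
    rcases ih with rfl | ⟨x, hx, hx'⟩
    · exact ⟨a g, by simpa using ha g, by simp⟩
    · refine ⟨a g * x, by simpa using h.mul_mem _ _ _ _ (ha g) hx, ?_⟩
      rw [List.map_cons, List.prod_cons, hx', Unitization.inr_mul]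

variable [IsScalarTower F A A] [SMulCommClass F A A]

/-- Moving two factors of degree 1 past one of degree g, together or one by one, gives θ_{1,g} =
θ_{1,g}². -/
theorem pair_one (h : IsRegularGrading 𝒜 θ) (g : G) : θ.pair 1 g = 1 := by
  obtain ⟨a, ha, h0⟩ := h.regularity 2 ![1, 1, g]
  have h1 : a 0 ∈ 𝒜 1 := ha 0
  have h2 : a 1 ∈ 𝒜 1 := ha 1
  have h3 : a 2 ∈ 𝒜 g := ha 2
  have e1 := h.mul_comm_smul (Commute.one_left g) (by simpa using h.mul_mem _ _ _ _ h1 h2) h3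
  have e2 : a 0 * a 1 * a 2 = (θ.pair 1 g : F) • ((θ.pair 1 g : F) • (a 2 * (a 0 * a 1))) := by
    rw [mul_assoc, h.mul_comm_smul (Commute.one_left g) h2 h3, mul_smul_comm, ← mul_assoc,
      h.mul_comm_smul (Commute.one_left g) h1 h3, smul_mul_assoc, mul_assoc]
  have h0' : a 0 * a 1 * a 2 ≠ 0 := h0
  rw [← e1] at e2
  exact Units.ext (smul_left_injective F h0' (by simpa using e2.symm))

theorem mul_comm_of_one (h : IsRegularGrading 𝒜 θ) {g : G} {x y : A}
    (hx : x ∈ 𝒜 1) (hy : y ∈ 𝒜 g) : x * y = y * x := by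
  rw [h.mul_comm_smul (Commute.one_left g) hx hy, h.pair_one, Units.val_one, one_smul]

/-- In xyz of degrees g, g⁻¹, g, swap x and y at the cost of θ_{g,g⁻¹}, exchange x and z for free,
then move yz, of degree 1, back past x. -/
theorem pair_inv (h : IsRegularGrading 𝒜 θ) {g : G} (hg : θ.pair g g = 1) :
    θ.pair g g⁻¹ = 1 := by
  obtain ⟨a, ha, h0⟩ := h.regularity 2 ![g, g⁻¹, g]
  have h1 : a 0 ∈ 𝒜 g := ha 0
  have h2 : a 1 ∈ 𝒜 g⁻¹ := ha 1
  have h3 : a 2 ∈ 𝒜 g := ha 2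
  have h0' : a 0 * a 1 * a 2 ≠ 0 := h0
  generalize a 0 = x, a 1 = y, a 2 = z at *
  have c1 : y * z * x = x * (y * z) :=
    h.mul_comm_of_one (by simpa using h.mul_mem _ _ _ _ h2 h3) h1
  have e : x * y * z = (θ.pair g g⁻¹ : F) • (x * y * z) := by
    conv_lhs => rw [h.mul_comm_smul (Commute.refl g).inv_right h1 h2, smul_mul_assoc, mul_assoc,
      h.mul_comm_of_pair_self hg h1 h3, ← mul_assoc, c1, ← mul_assoc]
  exact Units.ext (smul_left_injective F h0' (by simpa using e.symm))

theorem mul_comm_of_mul_eq_one (h : IsRegularGrading 𝒜 θ) {g k : G} (hg : θ.pair g g = 1)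
    (hgk : g * k = 1) {x y : A} (hx : x ∈ 𝒜 g) (hy : y ∈ 𝒜 k) : x * y = y * x := by
  obtain rfl := eq_inv_of_mul_eq_one_right hgk
  rw [h.mul_comm_smul (Commute.refl g).inv_right hx hy, h.pair_inv hg, Units.val_one, one_smul]

theorem mul_mul_swap (h : IsRegularGrading 𝒜 θ) {g k : G} (hg : θ.pair g g = 1)
    (hg' : θ.pair g⁻¹ g⁻¹ = 1) {x y q : A} (hx : x ∈ 𝒜 g) (hq : q ∈ 𝒜 k) (hy : y ∈ 𝒜 g) :
    x * q * y = y * q * x := by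
  have key : ∀ {x y q : A} (_ : x ∈ 𝒜 g) (_ : q ∈ 𝒜 k) (_ : y ∈ 𝒜 g),
      x * q * y = (θ 2 ![g, k, g] (Equiv.swap 0 2) : F) • (y * q * x) := by
    intro x y q hx hq hy
    have := h.commutation 2 ![g, k, g] (Equiv.swap 0 2) (by
      simp [tupleProd, Equiv.swap_apply_def, Fin.last]) ![x, q, y] (by
      intro i; fin_cases i <;> assumption)
    simpa [tupleProd, Equiv.swap_apply_def, Fin.last] using this
  suffices hθ : θ 2 ![g, k, g] (Equiv.swap 0 2) = 1 by
    rw [key hx hq hy, hθ, Units.val_one, one_smul]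
  -- The two factors of degree g⁻¹ pair with x and y to form elements of degree 1, which pass the
  -- middle factor freely; regularity for the padded tuple keeps the product nonzero.
  obtain ⟨a, ha, h0⟩ := h.regularity 4 ![g⁻¹, g⁻¹, g, k, g]
  have h1 : a 0 ∈ 𝒜 g⁻¹ := ha 0
  have h2 : a 1 ∈ 𝒜 g⁻¹ := ha 1
  have h3 : a 2 ∈ 𝒜 g := ha 2
  have h4 : a 3 ∈ 𝒜 k := ha 3
  have h5 : a 4 ∈ 𝒜 g := ha 4
  have h0' : a 0 * a 1 * a 2 * a 3 * a 4 ≠ 0 := h0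
  generalize a 0 = p, a 1 = p', a 2 = x, a 3 = b, a 4 = y at *
  have c1 : p * x * b = b * (p * x) :=
    h.mul_comm_of_one (by simpa using h.mul_mem _ _ _ _ h1 h3) h4
  have c2 : p * y * b = b * (p * y) :=
    h.mul_comm_of_one (by simpa using h.mul_mem _ _ _ _ h1 h5) h4
  have c3 : x * y = y * x := h.mul_comm_of_pair_self hg h3 h5
  have c4 : p * p' = p' * p := h.mul_comm_of_pair_self hg' h1 h2
  have e : p * p' * x * b * y = p * p' * (y * b * x) := by
    calc p * p' * x * b * y = p' * (p * x * b) * y := by rw [c4]; simp only [mul_assoc]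
      _ = p' * b * p * (x * y) := by rw [c1]; simp only [mul_assoc]
      _ = p' * (b * (p * y)) * x := by rw [c3]; simp only [mul_assoc]
      _ = _ := by rw [← c2, c4]; simp only [mul_assoc]
  have e' : p * p' * x * b * y =
      (θ 2 ![g, k, g] (Equiv.swap 0 2) : F) • (p * p' * (y * b * x)) := by
    rw [← mul_smul_comm, ← key h3 h4 h5]; simp only [mul_assoc]
  rw [← e] at e'
  exact Units.ext (smul_left_injective F h0' (by simpa using e'.symm))

theorem inr_mul_swap (h : IsRegularGrading 𝒜 θ) (hdiag : ∀ g, θ.pair g g = 1) {g : G} {x y : A}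
    (hx : x ∈ 𝒜 g) (hy : y ∈ 𝒜 g) (l : List (Unitization F A))
    (hl : ∀ z ∈ l, ∃ k, ∃ a ∈ 𝒜 k, z = Unitization.inr a) :
    (Unitization.inr x * l.prod * Unitization.inr y : Unitization F A) =
      Unitization.inr y * l.prod * Unitization.inr x := by
  have : l.prod = 1 ∨ ∃ k, ∃ a ∈ 𝒜 k, l.prod = Unitization.inr a := by
    induction l with
    | nil => simp
    | cons z l ih =>
      obtain ⟨k, a, ha, rfl⟩ := hl z (by simp)
      rcases ih (fun z hz => hl z (by simp [hz])) with h1 | ⟨k', a', ha', h1⟩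
      · exact Or.inr ⟨k, a, ha, by simp [h1]⟩
      · exact Or.inr ⟨k * k', a * a', h.mul_mem _ _ _ _ ha ha', by
          rw [List.prod_cons, h1, Unitization.inr_mul]⟩
  rcases this with h1 | ⟨k, a, ha, h1⟩
  · rw [h1, mul_one, mul_one, ← Unitization.inr_mul, ← Unitization.inr_mul,
      h.mul_comm_of_pair_self (hdiag g) hx hy]
  · rw [h1]
    simp only [← Unitization.inr_mul]
    rw [h.mul_mul_swap (hdiag g) (hdiag _) hx ha hy]

theorem prod_ofFn_swap (h : IsRegularGrading 𝒜 θ) (hdiag : ∀ g, θ.pair g g = 1) {n : ℕ}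
    (g : Fin n → G) (b : Fin n → A) (hb : ∀ i, b i ∈ 𝒜 (g i)) {i j : Fin n} (hij : i < j)
    (hg : g i = g j) :
    (List.ofFn fun k => (Unitization.inr (b (Equiv.swap i j k)) : Unitization F A)).prod =
      (List.ofFn fun k => (Unitization.inr (b k) : Unitization F A)).prod := by
  set L := List.ofFn fun k => (Unitization.inr (b k) : Unitization F A) with hL
  obtain ⟨P, Q, R, ⟨l, hl, rfl⟩, hPQR⟩ := L.exists_prod_set_set hij (by simp [hL])
  have e1 : L = (L.set i (Unitization.inr (b i))).set j (Unitization.inr (b j)) := by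
    refine List.ext_getElem (by simp) fun m h1 h2 => ?_
    simp only [hL, List.getElem_set, List.getElem_ofFn]
    grind
  have e2 : (List.ofFn fun k => (Unitization.inr (b (Equiv.swap i j k)) : Unitization F A)) =
      (L.set i (Unitization.inr (b j))).set j (Unitization.inr (b i)) := by
    refine List.ext_getElem (by simp [hL]) fun m h1 h2 => ?_
    simp only [hL, List.getElem_set, List.getElem_ofFn, Equiv.swap_apply_def, Fin.ext_iff]
    grind
  conv_rhs => rw [e1]
  rw [e2, hPQR, hPQR]
  have := h.inr_mul_swap hdiag (hb i) (hg ▸ hb j) l (by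
    intro z hz
    obtain ⟨k, rfl⟩ := List.mem_ofFn.1 (hl z hz)
    exact ⟨_, _, hb k, rfl⟩)
  simpa only [mul_assoc] using congrArg (fun z => P * z * R) this.symm

/-- Induction on the size of the support: composing with the transposition of i and σ i fixes one
more point and still preserves degrees. -/
theorem prod_ofFn_perm (h : IsRegularGrading 𝒜 θ) (hdiag : ∀ g, θ.pair g g = 1) {n : ℕ}
    (g : Fin n → G) (b : Fin n → A) (hb : ∀ i, b i ∈ 𝒜 (g i)) (σ : Equiv.Perm (Fin n))
    (hσ : ∀ i, g (σ i) = g i) :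
    (List.ofFn fun k => (Unitization.inr (b (σ k)) : Unitization F A)).prod =
      (List.ofFn fun k => (Unitization.inr (b k) : Unitization F A)).prod := by
  induction hm : σ.support.card using Nat.strong_induction_on generalizing σ b with
  | _ m ih =>
  by_cases h1 : σ = 1
  · simp [h1]
  obtain ⟨i, hi⟩ : ∃ i, σ i ≠ i := by
    by_contra! h2; exact h1 (Equiv.ext h2)
  have hsw : ∀ k, g (Equiv.swap i (σ i) k) = g k := by
    intro k
    rw [Equiv.swap_apply_def]
    split_ifs with h2 h2
    · rw [h2, hσ]
    · rw [h2, hσ]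
    · rfl
  have h2 := ih _ (hm ▸ Equiv.Perm.card_support_swap_mul hi) (fun k => b (Equiv.swap i (σ i) k))
    (fun k => hsw k ▸ hb _) (Equiv.swap i (σ i) * σ) (fun k => by simp [hsw, hσ]) rfl
  simp only [Equiv.Perm.mul_apply, Equiv.swap_apply_self] at h2
  rw [h2]
  rcases lt_or_gt_of_ne hi with h3 | h3
  · rw [Equiv.swap_comm]; exact h.prod_ofFn_swap hdiag g b hb h3 (hσ i)
  · exact h.prod_ofFn_swap hdiag g b hb h3 (hσ i).symm

end IsRegularGrading

/-! ### Permutations, divisibility and polarization -/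

theorem exists_perm_of_ofFn_perm {S : Type*} [DecidableEq S] {n : ℕ} {f g : Fin n → S}
    (h : (List.ofFn f).Perm (List.ofFn g)) : ∃ σ : Equiv.Perm (Fin n), f = g ∘ σ := by
  have hm : Multiset.map f Finset.univ.val = Multiset.map g Finset.univ.val := by
    rw [Fin.univ_val_map, Fin.univ_val_map]; exact Multiset.coe_eq_coe.2 h
  have hc : ∀ s, Fintype.card {i // f i = s} = Fintype.card {i // g i = s} := by
    intro s
    have := congrArg (Multiset.count s) hm
    rw [Multiset.count_map, Multiset.count_map] at this
    simp only [Fintype.card_subtype, eq_comm (b := s)]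
    simp only [eq_comm (a := s)] at this ⊢
    exact this
  exact ⟨Equiv.ofFiberEquiv fun s => Fintype.equivOfCardEq (hc s),
    funext fun i => (Equiv.ofFiberEquiv_map _ i).symm⟩

/-- F^× is divisible because F is algebraically closed, hence injective among abelian groups;
cancellation embeds Z in its Grothendieck group, where the identity of F^× extends. -/
theorem exists_retraction {F Z : Type*} [Field F] [IsAlgClosed F] [CharZero F] [CommMonoid Z]
    [IsCancelMul Z] (ι : Fˣ →* Z) (hι : Function.Injective ι) :
    ∃ r : Z →* Fˣ, ∀ s, r (ι s) = s := by
  have hroot : ∀ (n : ℕ), n ≠ 0 → ∀ s : Fˣ, ∃ t : Fˣ, t ^ n = s := by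
    intro n hn s
    obtain ⟨t, ht⟩ := IsAlgClosed.exists_pow_nat_eq (s : F) (Nat.pos_of_ne_zero hn)
    refine ⟨Units.mk0 t ?_, Units.ext ht⟩
    rintro rfl
    exact s.ne_zero (by rw [← ht, zero_pow hn])
  choose! root hr using hroot
  let _ : DivisibleBy (Additive Fˣ) ℕ :=
    { div := fun a n => if n = 0 then 0 else Additive.ofMul (root n a.toMul)
      div_zero := fun a => by simp
      div_cancel := fun {n} a hn => by
        rw [if_neg hn, ← ofMul_pow, hr n hn, ofMul_toMul] }
  let _ : DivisibleBy (Additive Fˣ) ℤ := AddGroup.divisibleByIntOfDivisibleByNat _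
  have hof : Function.Injective (Algebra.GrothendieckGroup.of (M := Z)) :=
    (Submonoid.LocalizationMap.top_injective_iff (Localization.monoidOf ⊤)).2 inferInstance
  obtain ⟨r, hr⟩ := (Module.Baer.of_divisible (Additive Fˣ)).extension_property_addMonoidHom
    (MonoidHom.toAdditive (Algebra.GrothendieckGroup.of.comp ι)) (hof.comp hι) (AddMonoidHom.id _)
  refine ⟨(MonoidHom.toAdditive.symm r).comp Algebra.GrothendieckGroup.of, fun s => ?_⟩
  exact congrArg Additive.toMul (DFunLike.congr_fun hr (Additive.ofMul s))

/-- Multilinear expressions that are invariant under the permutations of the variables preserving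
the labels `g` do not vanish identically on the tuples that depend on the labels only. -/
theorem MultilinearMap.exists_ne_zero_of_perm_invariant {F A B G : Type*} [Field F] [CharZero F]
    [DecidableEq G] [AddCommGroup A] [Module F A] [AddCommGroup B] [Module F B] {n : ℕ}
    (f : MultilinearMap F (fun _ : Fin n => A) B) (g : Fin n → G) (b : Fin n → A)
    (hf : ∀ σ : Equiv.Perm (Fin n), (∀ i, g (σ i) = g i) → f (fun i => b (σ i)) = f b)
    (h0 : f b ≠ 0) :
    ∃ t : Fin n → F, f (fun i => ∑ j ∈ Finset.univ.filter (fun j => g j = g i), t j • b j) ≠ 0 := by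
  classical
  obtain ⟨l, hl⟩ : ∃ l : Module.Dual F B, l (f b) ≠ 0 := by
    by_contra! h; exact h0 ((Module.forall_dual_apply_eq_zero_iff F _).1 h)
  by_contra! hz
  let T : Finset (Fin n → Fin n) :=
    Fintype.piFinset fun i => Finset.univ.filter (fun j => g j = g i)
  -- P(t) is l applied to f at the label-dependent combinations. Its coefficient at t₁⋯tₙ comes from
  -- the bijective φ only, so it is l(f b) times the number of label-preserving permutations,
  -- nonzero in characteristic zero.
  let P : MvPolynomial (Fin n) F :=
    ∑ φ ∈ T, MvPolynomial.monomial (∑ i, Finsupp.single (φ i) 1) (l (f fun i => b (φ i)))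
  have hP : P = 0 := by
    apply MvPolynomial.funext
    intro t
    have h1 := congrArg l (hz t)
    rw [MultilinearMap.map_sum_finset, _root_.map_sum, l.map_zero] at h1
    rw [_root_.map_zero, ← h1]
    simp only [P, _root_.map_sum]
    refine Finset.sum_congr rfl fun φ _ => ?_
    rw [MultilinearMap.map_smul_univ, map_smul, smul_eq_mul, MvPolynomial.monomial_sum_index]
    simp [MvPolynomial.eval_monomial, mul_comm]
  have hc := congrArg (MvPolynomial.coeff (∑ i, Finsupp.single i 1)) hP
  rw [MvPolynomial.coeff_zero, MvPolynomial.coeff_sum] at hc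
  simp only [MvPolynomial.coeff_monomial] at hc
  have hterm : ∀ φ ∈ T, (if (∑ i, Finsupp.single (φ i) 1 : Fin n →₀ ℕ) = ∑ i, Finsupp.single i 1
      then l (f fun i => b (φ i)) else 0) =
      if (∑ i, Finsupp.single (φ i) 1 : Fin n →₀ ℕ) = ∑ i, Finsupp.single i 1
      then l (f b) else 0 := by
    intro φ hφ
    split_ifs with h
    · have hsurj : Function.Surjective φ := by
        intro j
        by_contra! hj
        have := DFunLike.congr_fun h j
        simp [Finsupp.finsetSum_apply, Finsupp.single_apply, hj] at this
      have hφ' : ∀ i, g (φ i) = g i := by simpa [T] using hφ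
      rw [← hf (Equiv.ofBijective φ (Finite.surjective_iff_bijective.1 hsurj)) hφ']
      rfl
    · rfl
  rw [Finset.sum_congr rfl hterm, ← Finset.sum_filter, Finset.sum_const, nsmul_eq_mul] at hc
  rcases mul_eq_zero.1 hc with h | h
  · rw [Nat.cast_eq_zero, Finset.card_eq_zero] at h
    have : id ∈ (∅ : Finset (Fin n → Fin n)) := by rw [← h]; simp [T]
    simp at this
  · exact hl h

/-! ### The monoid of words of degree one -/

namespace IsRegularGrading

section

variable {G F A : Type*} [Field F] [NonUnitalRing A] [Module F A] [IsScalarTower F A A]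
    [SMulCommClass F A A] {𝒜 : G → Submodule F A}

/-- The value of a word of degrees, as a function of the homogeneous elements substituted for its
letters. -/
noncomputable def wordEval (𝒜 : G → Submodule F A) (w : List G) :
    ((g : G) → 𝒜 g) → Unitization F A :=
  fun a => (w.map fun g => (Unitization.inr (a g : A) : Unitization F A)).prod

theorem wordEval_append (w v : List G) :
    wordEval 𝒜 (w ++ v) = wordEval 𝒜 w * wordEval 𝒜 v := by
  ext1 a; simp [wordEval]

variable [Group G]

/-- The values of the words of degree one, with their contents and up to nonzero scalars. -/
def centralWords (𝒜 : G → Submodule F A) :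
    Submonoid (Multiplicative (Multiset G) × (((g : G) → 𝒜 g) → Unitization F A)) where
  carrier := {z | ∃ (w : List G) (s : Fˣ), w.prod = 1 ∧
    z = (Multiplicative.ofAdd (w : Multiset G), (s : F) • wordEval 𝒜 w)}
  one_mem' := ⟨[], 1, rfl, by rw [Units.val_one, one_smul]; rfl⟩
  mul_mem' := by
    rintro _ _ ⟨w, s, hw, rfl⟩ ⟨v, t, hv, rfl⟩
    refine ⟨w ++ v, s * t, by simp [hw, hv], ?_⟩
    rw [wordEval_append, Prod.mk_mul_mk, smul_mul_smul_comm, ← ofAdd_add, Multiset.coe_add,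
      Units.val_mul]

/-- The element of `centralWords 𝒜` given by a word of degree one and a scalar. -/
noncomputable def centralWord (𝒜 : G → Submodule F A) (w : List G) (hw : w.prod = 1) (s : Fˣ) :
    centralWords 𝒜 :=
  ⟨(Multiplicative.ofAdd (w : Multiset G), (s : F) • wordEval 𝒜 w), w, s, hw, rfl⟩

theorem centralWord_mul (w v : List G) (hw : w.prod = 1) (hv : v.prod = 1) (s t : Fˣ) :
    centralWord 𝒜 w hw s * centralWord 𝒜 v hv t =
      centralWord 𝒜 (w ++ v) (by simp [hw, hv]) (s * t) := by
  refine Subtype.ext (Prod.ext rfl ?_)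
  change (s : F) • wordEval 𝒜 w * (t : F) • wordEval 𝒜 v = ((s * t : Fˣ) : F) • wordEval 𝒜 (w ++ v)
  rw [wordEval_append, smul_mul_smul_comm, Units.val_mul]

theorem centralWord_eq_iff {w v : List G} {hw : w.prod = 1} {hv : v.prod = 1} {s t : Fˣ} :
    centralWord 𝒜 w hw s = centralWord 𝒜 v hv t ↔
      w.Perm v ∧ (s : F) • wordEval 𝒜 w = (t : F) • wordEval 𝒜 v := by
  rw [Subtype.ext_iff, Prod.ext_iff]
  exact and_congr_left' (Multiplicative.ofAdd.injective.eq_iff.trans Multiset.coe_eq_coe)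

end

variable {G F A : Type*} [Group G] [DecidableEq G] [Field F] [NonUnitalRing A]
    [Module F A] {𝒜 : G → Submodule F A} {θ : CommFun G F}
    [IsScalarTower F A A] [SMulCommClass F A A]

theorem exists_prod_ne_zero [CharZero F] (h : IsRegularGrading 𝒜 θ) (hdiag : ∀ g, θ.pair g g = 1)
    (w : List G) :
    ∃ a : (g : G) → 𝒜 g, (w.map fun g => (Unitization.inr (a g : A) : Unitization F A)).prod ≠ 0 := by
  rcases w with _ | ⟨g₀, w⟩
  · exact ⟨0, by simp⟩
  obtain ⟨n, g, hg⟩ : ∃ (n : ℕ) (g : Fin (n + 1) → G), g₀ :: w = List.ofFn g :=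
    ⟨w.length, (g₀ :: w).get, (List.ofFn_get _).symm⟩
  obtain ⟨b, hb, hb0⟩ := h.regularity n g
  let f : MultilinearMap F (fun _ : Fin (n + 1) => A) (Unitization F A) :=
    (MultilinearMap.mkPiAlgebraFin F (n + 1) (Unitization F A)).compLinearMap
      fun _ => Unitization.inrHom F F A
  have hf : ∀ c : Fin (n + 1) → A,
      f c = (List.ofFn fun i => (Unitization.inr (c i) : Unitization F A)).prod := fun _ => rfl
  obtain ⟨t, ht⟩ := f.exists_ne_zero_of_perm_invariant g b
    (fun σ hσ => h.prod_ofFn_perm hdiag g b hb σ hσ) (by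
      rw [hf]
      have h1 := map_tupleProd (Unitization.inr : A → Unitization F A) (Unitization.inr_mul F) b
      rw [tupleProd_eq_prod_ofFn] at h1
      change (List.ofFn (Unitization.inr ∘ b)).prod ≠ 0
      rw [← h1]
      exact fun h2 => hb0 (Unitization.inr_injective h2))
  refine ⟨fun x => ⟨∑ j ∈ Finset.univ.filter (fun j => g j = x), t j • b j,
    sum_mem fun j hj => Submodule.smul_mem _ _ ?_⟩, ?_⟩
  · rw [← (Finset.mem_filter.1 hj).2]; exact hb j
  · rw [hf] at ht
    rw [hg, List.map_ofFn]
    exact ht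

theorem wordEval_ne_zero [CharZero F] (h : IsRegularGrading 𝒜 θ) (hdiag : ∀ g, θ.pair g g = 1)
    (w : List G) : wordEval 𝒜 w ≠ 0 := by
  obtain ⟨a, ha⟩ := h.exists_prod_ne_zero hdiag w
  exact fun h0 => ha (congrFun h0 a)

theorem wordEval_ofFn (h : IsRegularGrading 𝒜 θ) {n : ℕ} (g : Fin (n + 1) → G)
    (σ : Equiv.Perm (Fin (n + 1))) (hσ : tupleProd g = tupleProd (g ∘ σ)) :
    wordEval 𝒜 (List.ofFn g) = (θ n g σ : F) • wordEval 𝒜 (List.ofFn (g ∘ σ)) := by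
  ext1 a
  have h1 := congrArg (Unitization.inr : A → Unitization F A)
    (h.commutation n g σ hσ (fun i => a (g i)) fun i => (a (g i)).2)
  rw [Unitization.inr_smul, map_tupleProd _ (Unitization.inr_mul F),
    map_tupleProd _ (Unitization.inr_mul F), tupleProd_eq_prod_ofFn, tupleProd_eq_prod_ofFn] at h1
  simp only [wordEval, List.map_ofFn, Pi.smul_apply]
  exact h1

/-- This is why `centralWords` records the letters: equal contents and equal degree make two words
proportional, which yields cancellation. -/
theorem exists_wordEval_eq_smul (h : IsRegularGrading 𝒜 θ) {w v : List G} (hwv : w.Perm v)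
    (hprod : w.prod = v.prod) : ∃ u : Fˣ, wordEval 𝒜 w = (u : F) • wordEval 𝒜 v := by
  rcases w with _ | ⟨g₀, w⟩
  · rw [List.nil_perm.1 hwv]
    exact ⟨1, by simp⟩
  obtain ⟨n, g, hg⟩ : ∃ (n : ℕ) (g : Fin (n + 1) → G), g₀ :: w = List.ofFn g :=
    ⟨w.length, (g₀ :: w).get, (List.ofFn_get _).symm⟩
  obtain ⟨k, rfl⟩ : ∃ k : Fin (n + 1) → G, v = List.ofFn k := by
    have : v.length = n + 1 := by rw [← hwv.length_eq, hg, List.length_ofFn]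
    exact ⟨v.get ∘ Fin.cast this.symm, 
      List.ext_getElem (by simp [this]) fun m h1 h2 => by rw [List.getElem_ofFn]; rfl⟩
  rw [hg] at hwv hprod ⊢
  obtain ⟨σ, rfl⟩ := exists_perm_of_ofFn_perm hwv.symm
  exact ⟨_, h.wordEval_ofFn g σ (by simpa [tupleProd_eq_prod_ofFn] using hprod)⟩

theorem wordEval_mul_comm (h : IsRegularGrading 𝒜 θ) (hdiag : ∀ g, θ.pair g g = 1)
    {w v : List G} (hwv : w.prod * v.prod = 1) :
    wordEval 𝒜 w * wordEval 𝒜 v = wordEval 𝒜 v * wordEval 𝒜 w := by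
  ext1 a
  rcases h.prod_inr_mem w (fun g => a g) fun g => (a g).2 with rfl | ⟨x, hx, hx'⟩
  · simp [wordEval]
  rcases h.prod_inr_mem v (fun g => a g) fun g => (a g).2 with rfl | ⟨y, hy, hy'⟩
  · simp [wordEval]
  simp only [Pi.mul_apply, wordEval]
  rw [hx', hy', ← Unitization.inr_mul, ← Unitization.inr_mul,
    h.mul_comm_of_mul_eq_one (hdiag _) hwv hx hy]

theorem centralWords_mul_comm (h : IsRegularGrading 𝒜 θ) (hdiag : ∀ g, θ.pair g g = 1)
    (x y : centralWords 𝒜) : x * y = y * x := by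
  obtain ⟨_, w, s, hw, rfl⟩ := x
  obtain ⟨_, v, t, hv, rfl⟩ := y
  refine Subtype.ext (Prod.ext (mul_comm _ _) ?_)
  change (s : F) • wordEval 𝒜 w * (t : F) • wordEval 𝒜 v =
    (t : F) • wordEval 𝒜 v * (s : F) • wordEval 𝒜 w
  rw [smul_mul_smul_comm, smul_mul_smul_comm, mul_comm (s : F), h.wordEval_mul_comm hdiag (w := w) (v := v)
    (by simp [hw, hv])]

theorem centralWords_mul_left_cancel [CharZero F] (h : IsRegularGrading 𝒜 θ)
    (hdiag : ∀ g, θ.pair g g = 1) {x y z : centralWords 𝒜} (hxyz : x * y = x * z) : y = z := by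
  obtain ⟨_, w, s, hw, rfl⟩ := x
  obtain ⟨_, v, t, hv, rfl⟩ := y
  obtain ⟨_, v', t', hv', rfl⟩ := z
  change centralWord 𝒜 w hw s * centralWord 𝒜 v hv t =
    centralWord 𝒜 w hw s * centralWord 𝒜 v' hv' t' at hxyz
  change centralWord 𝒜 v hv t = centralWord 𝒜 v' hv' t'
  rw [centralWord_mul, centralWord_mul, centralWord_eq_iff] at hxyz
  obtain ⟨hperm, heq⟩ := hxyz
  have hperm' := (List.perm_append_left_iff w).1 hperm
  rw [centralWord_eq_iff]
  refine ⟨hperm', ?_⟩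
  obtain ⟨u, hu⟩ := h.exists_wordEval_eq_smul hperm' (hv.trans hv'.symm)
  rw [wordEval_append, hu, mul_smul_comm, ← wordEval_append, smul_smul] at heq
  have := smul_left_injective F (h.wordEval_ne_zero hdiag (w ++ v')) heq
  rw [hu, smul_smul]
  congr 1
  rw [Units.val_mul, Units.val_mul, mul_assoc] at this
  exact mul_left_cancel₀ s.ne_zero this

/-- A regular grading with `θ_{g,g} = 1` admits a character on the words of degree one that is
compatible with the commutation function. -/
theorem exists_character [CharZero F] [IsAlgClosed F] (h : IsRegularGrading 𝒜 θ)
    (hdiag : ∀ g, θ.pair g g = 1) :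
    ∃ ρ : List G → Fˣ, (∀ w v, w.prod = 1 → v.prod = 1 → ρ (w ++ v) = ρ w * ρ v) ∧
      ∀ (w v : List G) (s : Fˣ), w.prod = 1 → v.prod = 1 → w.Perm v →
        wordEval 𝒜 w = (s : F) • wordEval 𝒜 v → ρ w = s * ρ v := by
  let _ : CommMonoid (centralWords 𝒜) :=
    { (inferInstance : Monoid (centralWords 𝒜)) with mul_comm := h.centralWords_mul_comm hdiag }
  have : IsLeftCancelMul (centralWords 𝒜) := ⟨fun _ _ _ => h.centralWords_mul_left_cancel hdiag⟩
  have : IsCancelMul (centralWords 𝒜) := CommMagma.IsLeftCancelMul.toIsCancelMul _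
  let ι : Fˣ →* centralWords 𝒜 :=
    { toFun := fun s => centralWord 𝒜 [] rfl s
      map_one' := Subtype.ext (by simp only [centralWord, Units.val_one, one_smul]; rfl)
      map_mul' := fun s t => (centralWord_mul [] [] rfl rfl s t).symm }
  have hι : Function.Injective ι := fun s t hst => Units.ext
    (smul_left_injective F (h.wordEval_ne_zero hdiag [])
      ((centralWord_eq_iff (hw := rfl) (hv := rfl)).1 hst).2)
  obtain ⟨r, hr⟩ := exists_retraction ι hι
  refine ⟨fun w => if hw : w.prod = 1 then r (centralWord 𝒜 w hw 1) else 1, ?_, ?_⟩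
  · intro w v hw hv
    have hwv : (w ++ v).prod = 1 := by simp [hw, hv]
    beta_reduce
    rw [dif_pos hw, dif_pos hv, dif_pos hwv, ← map_mul]
    refine congrArg r (Eq.trans ?_ (centralWord_mul w v hw hv 1 1).symm)
    simp only [mul_one]
  · intro w v s hw hv hperm heq
    beta_reduce
    rw [dif_pos hw, dif_pos hv, ← hr s, ← map_mul]
    exact congrArg r ((centralWord_eq_iff.2 ⟨hperm, by simpa using heq⟩).trans
      (centralWord_mul [] v List.prod_nil hv s 1).symm)

/-! ### The cocycle and its twisted group algebra -/

theorem exists_twoCocycle [CharZero F] [IsAlgClosed F] (h : IsRegularGrading 𝒜 θ)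
    (hdiag : ∀ g, θ.pair g g = 1) :
    ∃ (α : TwoCocycle G Fˣ) (μ : List G → Fˣ), (∀ g, μ [g] = 1) ∧
      (∀ w v, μ (w ++ v) = μ w * μ v * α.toFun w.prod v.prod) ∧
      ∀ (w v : List G) (s : Fˣ), w.prod = v.prod → w.Perm v →
        wordEval 𝒜 w = (s : F) • wordEval 𝒜 v → μ w = s * μ v := by
  obtain ⟨ρ, hmul, hperm⟩ := h.exists_character hdiag
  have hcomm : ∀ w v, w.prod * v.prod = 1 → ρ (w ++ v) = ρ (v ++ w) := by
    intro w v hwv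
    rw [hperm (w ++ v) (v ++ w) 1 (by simpa using hwv)
      (by simpa using mul_eq_one_comm.1 hwv) List.perm_append_comm
      (by rw [wordEval_append, wordEval_append, h.wordEval_mul_comm hdiag hwv]; simp), one_mul]
  -- μ(w) compares w with the single letter of the same degree, both completed to degree one; by
  -- `hμ` the completion does not matter. It is the intended coefficient in U_{g₁}⋯U_{gₙ} = μ(w)
  -- U_{g₁⋯gₙ}.
  let μ : List G → Fˣ := fun w => ρ (w ++ [w.prod⁻¹]) / ρ ([w.prod] ++ [w.prod⁻¹])
  have hμ : ∀ w v : List G, w.prod * v.prod = 1 → ρ (w ++ v) = μ w * ρ ([w.prod] ++ v) := by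
    intro w v hwv
    have hv : v.prod = w.prod⁻¹ := eq_inv_of_mul_eq_one_right hwv
    have e : ρ (w ++ v) * ρ ([w.prod] ++ [w.prod⁻¹]) =
        ρ (w ++ [w.prod⁻¹]) * ρ ([w.prod] ++ v) := by
      calc ρ (w ++ v) * ρ ([w.prod] ++ [w.prod⁻¹])
          = ρ (w ++ (v ++ ([w.prod] ++ [w.prod⁻¹]))) := by
            rw [← hmul _ _ (by simp [hv]) (by simp), List.append_assoc]
        _ = ρ ((v ++ [w.prod]) ++ ([w.prod⁻¹] ++ w)) := by
            rw [hcomm _ _ (by simp [hv])]; simp only [List.append_assoc]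
        _ = ρ (v ++ [w.prod]) * ρ ([w.prod⁻¹] ++ w) := hmul _ _ (by simp [hv]) (by simp)
        _ = _ := by
            rw [hcomm v _ (by simp [hv]), hcomm _ w (by simp), mul_comm]
    rw [div_mul_eq_mul_div, eq_div_iff_mul_eq', e]
  have hμ1 : ∀ g, μ [g] = 1 := fun g => by simp [μ]
  -- After completing by u, replace w and then v by single letters, rotating cyclically in between;
  -- the remaining word [w.prod, v.prod] contributes the last factor.
  have hadd : ∀ w v, μ (w ++ v) = μ w * μ v * μ [w.prod, v.prod] := by
    intro w v
    set u : List G := [(w.prod * v.prod)⁻¹] with hu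
    have e1 := hμ (w ++ v) u (by simp [hu])
    have e2 := hμ w (v ++ u) (by simp [hu])
    have e3 := hcomm [w.prod] (v ++ u) (by simp [hu])
    have e4 := hμ v (u ++ [w.prod]) (by simp [hu])
    have e5 := hcomm [w.prod] ([v.prod] ++ u) (by simp [hu])
    have e6 := hμ [w.prod, v.prod] u (by simp [hu])
    rw [List.append_assoc, e2, e3, List.append_assoc, e4, ← List.append_assoc [v.prod], ← e5,
      ← List.append_assoc [w.prod], List.singleton_append (l := [v.prod]), e6] at e1
    simp only [List.prod_append, List.prod_cons, List.prod_nil, mul_one] at e1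
    rw [← mul_assoc, ← mul_assoc] at e1
    exact (mul_right_cancel e1).symm
  refine ⟨⟨fun g k => μ [g, k], fun g k l => ?_⟩, μ, hμ1, hadd, ?_⟩
  -- Both sides of the cocycle identity equal μ([g, k, l]).
  · have e1 := hadd [g, k] [l]
    have e2 := hadd [g] [k, l]
    simp only [hμ1, List.prod_cons, List.prod_nil, mul_one, one_mul] at e1 e2
    rw [← e1, ← e2]
    rfl
  · intro w v s hprod hwv heq
    have hwu : (w ++ [w.prod⁻¹]).prod = 1 := by simp
    have hvu : (v ++ [w.prod⁻¹]).prod = 1 := by simp [hprod]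
    have := hperm _ _ s hwu hvu (hwv.append_right _) (by
      rw [wordEval_append, wordEval_append, heq, smul_mul_assoc])
    simp only [μ]
    rw [this, hprod, mul_div_assoc]

/-- A regularly graded algebra with `θ_{g,g} = 1` has the commutation function of a twisted group
algebra. -/
theorem exists_twistedGroupAlgebra [CharZero F] [IsAlgClosed F]
    (h : IsRegularGrading 𝒜 θ) (hdiag : ∀ g, θ.pair g g = 1) :
    ∃ α : TwoCocycle G Fˣ, IsRegularGrading (TwistedGroupAlgebra.grading α) θ := by
  obtain ⟨α, μ, hμ1, hadd, hperm⟩ := h.exists_twoCocycle hdiag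
  have htuple : ∀ (n : ℕ) (g : Fin (n + 1) → G),
      tupleProd (fun i => TwistedGroupAlgebra.basis α (g i)) =
        (μ (List.ofFn g) : F) • TwistedGroupAlgebra.basis α (tupleProd g) := by
    intro n
    induction n with
    | zero => intro g; simp [tupleProd, hμ1]
    | succ n ih =>
      intro g
      rw [List.ofFn_succ', List.concat_eq_append, hadd, hμ1, mul_one, tupleProd, ih,
        smul_mul_assoc, TwistedGroupAlgebra.basis_mul, smul_smul, ← Units.val_mul,
        ← tupleProd_eq_prod_ofFn, List.prod_singleton]
      rfl
  have hmem : ∀ {g : G} {x : TwistedGroupAlgebra α}, x ∈ TwistedGroupAlgebra.grading α g →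
      ∃ c : F, c • TwistedGroupAlgebra.basis α g = x := Submodule.mem_span_singleton.1
  have hsmul : ∀ (n : ℕ) (c : Fin (n + 1) → F) (x : Fin (n + 1) → TwistedGroupAlgebra α),
      tupleProd (fun i => c i • x i) = (∏ i, c i) • tupleProd x := by
    intro n c x
    rw [tupleProd_eq_prod_ofFn, tupleProd_eq_prod_ofFn]
    exact (MultilinearMap.mkPiAlgebraFin F (n + 1) (TwistedGroupAlgebra α)).map_smul_univ c x
  refine ⟨α, ⟨?_, ?_, ?_, ?_⟩⟩
  · refine DirectSum.isInternal_submodule_of_iSupIndep_of_iSup_eq_top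
      (TwistedGroupAlgebra.basis α).linearIndependent.iSupIndep_span_singleton ?_
    rw [← (TwistedGroupAlgebra.basis α).span_eq, Submodule.span_range_eq_iSup]
    rfl
  · intro g k a b ha hb
    obtain ⟨c, rfl⟩ := hmem ha
    obtain ⟨d, rfl⟩ := hmem hb
    rw [smul_mul_smul_comm, TwistedGroupAlgebra.basis_mul, smul_smul]
    exact Submodule.smul_mem _ _ (Submodule.mem_span_singleton_self _)
  · intro n g σ hσ a ha
    choose c hc using fun i => hmem (ha i)
    obtain rfl : (fun i => c i • TwistedGroupAlgebra.basis α (g i)) = a := funext hc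
    have e : tupleProd ((fun i => c i • TwistedGroupAlgebra.basis α (g i)) ∘ σ) =
        (∏ i, c i) • (μ (List.ofFn (g ∘ σ)) : F) •
          TwistedGroupAlgebra.basis α (tupleProd g) := by
      rw [hσ, ← htuple, ← Equiv.prod_comp σ c]
      exact hsmul n (c ∘ σ) _
    rw [e, hsmul, htuple, hperm (List.ofFn g) (List.ofFn (g ∘ σ)) (θ n g σ)
      (by simpa [tupleProd_eq_prod_ofFn] using hσ) (σ.ofFn_comp_perm g).symm
      (h.wordEval_ofFn g σ hσ), Units.val_mul, smul_smul, smul_smul, smul_smul]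
    congr 1
    ring
  · intro n g
    refine ⟨fun i => TwistedGroupAlgebra.basis α (g i),
      fun i => Submodule.mem_span_singleton_self _, ?_⟩
    rw [htuple]
    exact smul_ne_zero (Units.ne_zero _) ((TwistedGroupAlgebra.basis α).ne_zero _)

end IsRegularGrading

theorem mainTheorem4 {F : Type*} [Field F] [IsAlgClosed F] [CharZero F]
    {G : Type*} [Group G] [Fintype G] [DecidableEq G]
    {A : Type*} [NonUnitalRing A] [Module F A] [IsScalarTower F A A] [SMulCommClass F A A]
    (𝒜 : G → Submodule F A) (θ : CommFun G F)
    (hreg : IsRegularGrading 𝒜 θ) (hnd : θ.Nondegenerate) (hdiag : ∀ g : G, θ.pair g g = 1) :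
    ∃ r : ℕ, Fintype.card G = r ^ 2 ∧
      (∃ α : TwoCocycle G Fˣ, IsRegularGrading (TwistedGroupAlgebra.grading α) θ) ∧
      ∀ α : TwoCocycle G Fˣ, IsRegularGrading (TwistedGroupAlgebra.grading α) θ →
        Nonempty (TwistedGroupAlgebra α ≃ₐ[F] Matrix (Fin r) (Fin r) F) ∧
        ∀ φ : TwistedGroupAlgebra α ≃ₐ[F] Matrix (Fin r) (Fin r) F,
          (TwistedGroupAlgebra.toScalarMatrix α φ
              (TwistedGroupAlgebra.commutationMatrix α)).det = (r : F) ^ (r ^ 3) ∨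
          (TwistedGroupAlgebra.toScalarMatrix α φ
              (TwistedGroupAlgebra.commutationMatrix α)).det = -(r : F) ^ (r ^ 3) := by
  obtain ⟨α₀, hα₀⟩ := hreg.exists_twistedGroupAlgebra hdiag
  obtain ⟨r, hr, -⟩ := TwistedGroupAlgebra.exists_algEquiv_matrix α₀ hα₀ hnd
  refine ⟨r, hr, ⟨α₀, hα₀⟩, fun α hα => ⟨?_, fun φ => ?_⟩⟩
  · obtain ⟨r', hr', hφ⟩ := TwistedGroupAlgebra.exists_algEquiv_matrix α hα hnd
    -- The size is determined by |G|, so the r obtained from `α₀` serves every α.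
    obtain rfl : r' = r := Nat.pow_left_injective two_ne_zero (hr'.symm.trans hr)
    exact hφ
  · exact TwistedGroupAlgebra.det_commutationMatrix α hα hnd φ hr
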